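/- Let $V\subset\mathbb{R}^3$ be a bounded, open, convex set, and let $\sigma_S,\sigma_A$ be measurable functions on $V$, each bounded above and below pointwise on $V$ by strictly positive constants. Put $\sigma=\sigma_S+\sigma_A$, and let $Q\in L^2(V)$. Write $$\mathcal{T}\psi(\mathbf r,\Omega)=\Omega\cdot\nabla\psi(\mathbf r,\Omega)+\sigma(\mathbf r)\psi(\mathbf r,\Omega),\qquad \mathcal{P}\psi(\mathbf r)=\frac1{4\pi}\int_{\mathbb{S}^2}\psi(\mathbf r,\Omega)\,d\Omega ,$$ for $\mathbf r\in V$, $\Omega\in\mathbb{S}^2$. For $g\in L^2(V)$, a measurable function $\psi$ on $V\times\mathbb{S}^2$ is said to solve $\mathcal{T}\psi=g$ with vacuum boundary condition if, for almost every $(\mathbf r,\Omega)\in V\times\mathbb S^2$, the function $t\mapsto\psi(\mathbf r+t\Omega,\Omega)$ is locally absolutely continuous on $\{t:\mathbf r+t\Omega\in V\}$ and tends to $0$ at the end where the line enters $V$ (in the direction $\Omega$), and $\mathcal{T}\psi(\mathbf r,\Omega)=g(\mathbf r)$ for almost every $(\mathbf r,\Omega)$, where $\Omega\cdot\nabla\psi$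 is the derivative in the direction $\Omega$. Let $\psi\in L^2(V\times\mathbb{S}^2)$ solve the radiative transport equation $\mathcal{T}\psi=\sigma_S\phi+Q$, $\phi=\mathcal{P}\psi$, with vacuum boundary condition. Let $\phi^0\in L^2(V)$, and let $\phi^1,\phi^2,\dots$ be generated by source iteration: for $i\ge 0$, $\psi^{i+1}$ solves $\mathcal{T}\psi^{i+1}=\sigma_S\phi^i+Q$ with vacuum boundary condition, and $\phi^{i+1}=\mathcal{P}\psi^{i+1}$. Then the errors $e^i=\phi-\phi^i$ belong to $L^2(V)$ and, with $\|v\|_{L^2(V,\sigma)}^2=\int_V|v(\mathbf r)|^2\sigma(\mathbf r)\,d\mathbf r$, satisfy $$\|e^{i+1}\|_{L^2(V,\sigma)}\le\Big\|\frac{\sigma_S}{\sigma}\Big\|_{L^\infty(V)}\|e^i\|_{L^2(V,\sigma)}\qquad\text{for all } i\ge 0 .$$ Moreover $\|\sigma_S/\sigma\|_{L^\infty(V)}<1$, and $\|e^i\|_{L^2(V,\sigma)}\to0$ as $i\to\infty$. -/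

import Mathlib

open MeasureTheory Filter Topology
open scoped ENNReal

namespace RadiativeTransport

/-- Three-dimensional Euclidean space. -/
abbrev Space : Type := EuclideanSpace ℝ (Fin 3)

/-- The unit sphere `𝕊²` of directions. -/
abbrev Direction : Type := Metric.sphere (0 : Space) 1

/-- Surface measure on `𝕊²` (total mass `4π`). -/
noncomputable abbrev surfaceMeasure : Measure Direction := (volume : Measure Space).toSphere

/-- The measure `dr dΩ` on `V × 𝕊²`. -/
noncomputable abbrev phaseMeasure (V : Set Space) : Measure (Space × Direction) :=
  (volume.restrict V).prod surfaceMeasure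

/-- `s` is a (heterogeneous) cross-section on `V`: it is measurable and bounded above and below,
pointwise on `V`, by strictly positive constants. -/
def IsCrossSection (V : Set Space) (s : Space → ℝ) : Prop :=
  AEMeasurable s (volume.restrict V) ∧
    ∃ m M : ℝ, 0 < m ∧ ∀ r ∈ V, m ≤ s r ∧ s r ≤ M

/-- The transport operator `(𝒯ψ)(r, Ω) = Ω · ∇ψ(r, Ω) + σ(r) ψ(r, Ω)`, where `Ω · ∇ψ` is the
derivative of `ψ(·, Ω)` in the direction `Ω`. -/
noncomputable def transportOp (σ : Space → ℝ) (ψ : Space → Direction → ℝ)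
    (r : Space) (Ω : Direction) : ℝ :=
  lineDeriv ℝ (fun x => ψ x Ω) r (Ω : Space) + σ r * ψ r Ω

/-- The averaging operator `(𝒫ψ)(r) = (1/4π) ∫_{𝕊²} ψ(r, Ω) dΩ`. -/
noncomputable def average (ψ : Space → Direction → ℝ) (r : Space) : ℝ :=
  (1 / (4 * Real.pi)) * ∫ Ω, ψ r Ω ∂surfaceMeasure

/-- The distance `d(r, Ω) = inf {s > 0 : r - sΩ ∉ V}` from `r` back to the boundary of `V`. -/
noncomputable def exitDistance (V : Set Space) (r : Space) (Ω : Direction) : ℝ :=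
  sInf {s : ℝ | 0 < s ∧ r - s • (Ω : Space) ∉ V}

/-- `ψ` solves the pure transport problem `𝒯ψ = g` in `V × 𝕊²`, subject to the vacuum boundary
condition. As `σ` and `g` are only measurable, the problem is understood in the usual sense of
characteristics: on almost every chord of `V`, `ψ` is locally absolutely continuous, and the
equation holds almost everywhere in `V × 𝕊²`. For `r` in an open convex `V`, the point
`r - d(r, Ω) Ω` is where the characteristic through `r` enters `V`, that is, a point of `∂V` with
`n · Ω < 0` for the outward normal `n`; the boundary value there is the limit along the
characteristic. -/
structure IsTransportSolution (V : Set Space) (σ g : Space → ℝ)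
    (ψ : Space → Direction → ℝ) : Prop where
  measurable : AEStronglyMeasurable (fun p : Space × Direction => ψ p.1 p.2) (phaseMeasure V)
  absolutelyContinuous : ∀ᵐ p ∂(phaseMeasure V), ∀ a b : ℝ,
    (∀ t ∈ Set.uIcc a b, p.1 + t • (p.2 : Space) ∈ V) →
      AbsolutelyContinuousOnInterval (fun t => ψ (p.1 + t • (p.2 : Space)) p.2) a b
  equation : ∀ᵐ p ∂(phaseMeasure V),
    LineDifferentiableAt ℝ (fun x => ψ x p.2) p.1 (p.2 : Space) ∧
      transportOp σ ψ p.1 p.2 = g p.1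
  vacuum : ∀ᵐ p ∂(phaseMeasure V),
    Tendsto (fun s => ψ (p.1 - s • (p.2 : Space)) p.2) (𝓝[<] (exitDistance V p.1 p.2)) (𝓝 0)

/-- `ψ ∈ L²(V × 𝕊²)` solves the radiative transport equation `𝒯ψ = σ_S 𝒫ψ + Q` subject to the
vacuum boundary condition. -/
def IsRTESolution (V : Set Space) (σ σS Q : Space → ℝ) (ψ : Space → Direction → ℝ) : Prop :=
  MemLp (fun p : Space × Direction => ψ p.1 p.2) 2 (phaseMeasure V) ∧
    IsTransportSolution V σ (fun r => σS r * average ψ r + Q r) ψ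

/-- `φ⁰, φ¹, φ², …` are generated by source iteration from the initial guess `φ⁰ ∈ L²(V)`: for
every `i`, `φⁱ⁺¹ = 𝒫ψⁱ⁺¹` on `V`, where `ψⁱ⁺¹` solves `𝒯ψⁱ⁺¹ = σ_S φⁱ + Q` subject to the vacuum
boundary condition. -/
def IsSourceIteration (V : Set Space) (σ σS Q : Space → ℝ) (φ : ℕ → Space → ℝ) : Prop :=
  MemLp (φ 0) 2 (volume.restrict V) ∧
    ∀ i, ∃ ψ : Space → Direction → ℝ,
      IsTransportSolution V σ (fun r => σS r * φ i r + Q r) ψ ∧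
        ∀ r ∈ V, φ (i + 1) r = average ψ r

/-- The weighted norm `‖v‖_{L²(V, w)} = (∫_V |v|² w dr)^{1/2}`, with value `∞` allowed. -/
noncomputable def weightedNorm (V : Set Space) (w v : Space → ℝ) : ℝ≥0∞ :=
  (∫⁻ r in V, ENNReal.ofReal (|v r| ^ 2 * w r)) ^ (1 / 2 : ℝ)

/-- The norm `‖v‖_{L^∞(V)}`. -/
noncomputable def supNorm (V : Set Space) (v : Space → ℝ) : ℝ≥0∞ :=
  eLpNorm v ∞ (volume.restrict V)

end RadiativeTransport

/-! By linearity `ψ - ψⁱ⁺¹` solves the transport problem with source `g = σ_S eⁱ` and vacuum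
boundary values. On a characteristic this reads `u' + σu = g`, and `(g - σu)² ≥ 0` gives `(u²)' +
σu² ≤ g²/σ`. Since `u` vanishes at the inflow end and `u²` is nonnegative at the outflow end, `∫ σu²
≤ ∫ g²/σ` on each chord (`lintegral_Ioo_energy_le`).

Tonelli over parallel lines, then over directions, turns this into a bound on phase space with a
factor `4π`, because `g` is isotropic. Cauchy–Schwarz for `𝒫` gives back `1/(4π)`, so `‖𝒫ψ‖²` with
weight `σ` is at most `∫ g²/σ` (`IsTransportSolution.lintegral_average_le`). For `g = σ_S e` the
integrand is `(σ_S/σ)² e² σ`, hence the contraction factor, which is below 1 because `σ_A` is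
bounded below and `σ_S` above. -/

namespace RadiativeTransport

/-! ### Energy estimate on one characteristic -/

/-- Energy estimate for `u' + s u = g` on a compact interval. -/
theorem lintegral_Icc_energy_le {u s g : ℝ → ℝ} {a b M : ℝ} (hab : a ≤ b)
    (hu : AbsolutelyContinuousOnInterval u a b)
    (hs : AEMeasurable s (volume.restrict (Set.Icc a b)))
    (hs0 : ∀ t ∈ Set.Icc a b, 0 < s t) (hsM : ∀ t ∈ Set.Icc a b, s t ≤ M)
    (heq : ∀ᵐ t, t ∈ Set.Icc a b → HasDerivAt u (g t - s t * u t) t) :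
    ∫⁻ t in Set.Icc a b, ENNReal.ofReal (|u t| ^ 2 * s t) ≤
      ENNReal.ofReal (u a ^ 2) + ∫⁻ t in Set.Icc a b, ENNReal.ofReal (g t ^ 2 / s t) := by
  have hsq : AbsolutelyContinuousOnInterval (fun t => u t * u t) a b := hu.fun_mul hu
  have hw : IntegrableOn (deriv fun t => u t * u t) (Set.Icc a b) := by
    have := hsq.intervalIntegrable_deriv
    rwa [intervalIntegrable_iff_integrableOn_Icc_of_le hab] at this
  have hcont : ContinuousOn u (Set.Icc a b) := by
    simpa [Set.uIcc_of_le hab] using hu.continuousOn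
  have hs_int : IntegrableOn s (Set.Icc a b) := by
    refine Integrable.of_bound hs.aestronglyMeasurable M ?_
    filter_upwards [ae_restrict_mem measurableSet_Icc] with t ht
    rw [Real.norm_of_nonneg (hs0 t ht).le]
    exact hsM t ht
  have hus : IntegrableOn (fun t => |u t| ^ 2 * s t) (Set.Icc a b) := by
    simp only [sq_abs]
    exact hs_int.continuousOn_mul (hcont.pow 2) isCompact_Icc
  have hftc : ∫ t in Set.Icc a b, deriv (fun t => u t * u t) t = u b * u b - u a * u a := by
    rw [integral_Icc_eq_integral_Ioc, ← intervalIntegral.integral_of_le hab]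
    exact hsq.integral_deriv_eq_sub
  have hpt : ∀ᵐ t ∂volume.restrict (Set.Icc a b),
      deriv (fun t => u t * u t) t + |u t| ^ 2 * s t ≤ g t ^ 2 / s t := by
    rw [ae_restrict_iff' measurableSet_Icc]
    filter_upwards [heq] with t ht hmem
    have hd := (ht hmem).mul (ht hmem)
    have hst := hs0 t hmem
    rw [show deriv (fun t => u t * u t) t = _ from hd.deriv, sq_abs, le_div_iff₀ hst]
    -- After multiplication by `s > 0` the claim is `2gsu - s²u² ≤ g²`.
    nlinarith [sq_nonneg (g t - s t * u t)]
  -- `g²/s` need not be integrable, so its integral stays in `ℝ≥0∞`. The integrand on the left may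
  -- change sign; its negative part is discarded.
  have hle : ENNReal.ofReal (∫ t in Set.Icc a b,
      (deriv (fun t => u t * u t) t + |u t| ^ 2 * s t)) ≤
      ∫⁻ t in Set.Icc a b, ENNReal.ofReal (g t ^ 2 / s t) := by
    refine le_trans ?_ (lintegral_mono_ae (hpt.mono fun t ht => ENNReal.ofReal_le_ofReal ht))
    have hint : IntegrableOn (fun t => deriv (fun t => u t * u t) t + |u t| ^ 2 * s t)
        (Set.Icc a b) := hw.add hus
    rw [integral_eq_lintegral_pos_part_sub_lintegral_neg_part hint]
    refine (ENNReal.ofReal_le_ofReal (sub_le_self _ ENNReal.toReal_nonneg)).trans ?_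
    exact ENNReal.ofReal_toReal_le
  rw [← ofReal_integral_eq_lintegral_ofReal hus]
  · refine le_trans ?_ (add_le_add_right hle _)
    rw [integral_add hw hus, hftc]
    refine le_trans (ENNReal.ofReal_le_ofReal ?_) ENNReal.ofReal_add_le
    nlinarith [sq_nonneg (u b)]
  · filter_upwards [ae_restrict_mem measurableSet_Icc] with t ht
    exact mul_nonneg (by positivity) (hs0 t ht).le

/-- Energy estimate for `u' + s u = g` on an open interval, with zero inflow at the left end. -/
theorem lintegral_Ioo_energy_le {u s g : ℝ → ℝ} {A B M : ℝ} (hAB : A < B)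
    (hu : ∀ a b, Set.uIcc a b ⊆ Set.Ioo A B → AbsolutelyContinuousOnInterval u a b)
    (hs : AEMeasurable s (volume.restrict (Set.Ioo A B)))
    (hs0 : ∀ t ∈ Set.Ioo A B, 0 < s t) (hsM : ∀ t ∈ Set.Ioo A B, s t ≤ M)
    (heq : ∀ᵐ t, t ∈ Set.Ioo A B → HasDerivAt u (g t - s t * u t) t)
    (h0 : Tendsto u (𝓝[>] A) (𝓝 0)) :
    ∫⁻ t in Set.Ioo A B, ENNReal.ofReal (|u t| ^ 2 * s t) ≤
      ∫⁻ t in Set.Ioo A B, ENNReal.ofReal (g t ^ 2 / s t) := by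
  -- Exhaust the interval by compact ones on which `u` is absolutely continuous; the midpoint keeps
  -- `x n < y n`. Only the left end needs a limit of `u`.
  obtain ⟨x, -, hx, hxA⟩ := exists_seq_strictAnti_tendsto' (show A < (A + B) / 2 by linarith)
  obtain ⟨y, -, hy, hyB⟩ := exists_seq_strictMono_tendsto' (show (A + B) / 2 < B by linarith)
  have hsub : ∀ n, Set.Icc (x n) (y n) ⊆ Set.Ioo A B := fun n =>
    Set.Icc_subset_Ioo (hx n).1 (hy n).2
  have hxy : ∀ n, x n ≤ y n := fun n => ((hx n).2.trans (hy n).1).le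
  have hcover : AECover (volume.restrict (Set.Ioo A B)) atTop fun n => Set.Icc (x n) (y n) :=
    aecover_Ioo_of_Icc hxA hyB
  have hcont : ContinuousOn u (Set.Ioo A B) := by
    intro t ht
    obtain ⟨p, hp, hp'⟩ := exists_between ht.1
    obtain ⟨q, hq, hq'⟩ := exists_between ht.2
    have hpq : p ≤ q := (hp'.trans hq).le
    have := (hu p q (by rw [Set.uIcc_of_le hpq]; exact Set.Icc_subset_Ioo hp hq')).continuousOn
    rw [Set.uIcc_of_le hpq] at this
    exact (this.continuousAt (Icc_mem_nhds hp' hq)).continuousWithinAt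
  have hmeas : AEMeasurable (fun t => ENNReal.ofReal (|u t| ^ 2 * s t))
      (volume.restrict (Set.Ioo A B)) := by
    have := (hcont.abs.pow 2).aemeasurable measurableSet_Ioo (μ := volume)
    exact (this.mul hs).ennreal_ofReal
  have hlim := hcover.lintegral_tendsto_of_countably_generated hmeas
  have hua : Tendsto (fun n => ENNReal.ofReal (u (x n) ^ 2) +
      ∫⁻ t in Set.Ioo A B, ENNReal.ofReal (g t ^ 2 / s t)) atTop
      (𝓝 (ENNReal.ofReal (0 ^ 2) + ∫⁻ t in Set.Ioo A B, ENNReal.ofReal (g t ^ 2 / s t))) := by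
    refine Tendsto.add (ENNReal.tendsto_ofReal (Tendsto.pow (h0.comp ?_) 2)) tendsto_const_nhds
    exact tendsto_nhdsWithin_iff.2 ⟨hxA, Eventually.of_forall fun n => (hx n).1⟩
  rw [show ENNReal.ofReal ((0 : ℝ) ^ 2) = 0 by simp, zero_add] at hua
  refine le_of_tendsto_of_tendsto' hlim hua fun n => ?_
  rw [Measure.restrict_restrict measurableSet_Icc, Set.inter_eq_left.2 (hsub n)]
  refine (lintegral_Icc_energy_le (hxy n) (hu _ _ (by rw [Set.uIcc_of_le (hxy n)]; exact hsub n))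
    (hs.mono_measure (Measure.restrict_mono (hsub n) le_rfl)) (fun t ht => hs0 t (hsub n ht))
    (fun t ht => hsM t (hsub n ht)) (heq.mono fun t h ht => h (hsub n ht))).trans ?_
  gcongr
  exact hsub n

/-! ### Integration along parallel lines -/

/-- For fixed `t` the map is a translation. This lets a.e. statements in space pass to almost every
time on almost every line. -/
theorem quasiMeasurePreserving_line (v : Space) :
    Measure.QuasiMeasurePreserving (fun p : Space × ℝ => p.1 + p.2 • v)
      ((volume : Measure Space).prod volume) volume := by
  refine QuasiMeasurePreserving.prod_of_left (by fun_prop) (Eventually.of_forall fun t => ?_)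
  exact (measurePreserving_add_right volume (t • v)).quasiMeasurePreserving

theorem ae_ae_line {P : Space → Prop} (h : ∀ᵐ x, P x) (v : Space) :
    ∀ᵐ r : Space, ∀ᵐ t : ℝ, P (r + t • v) :=
  Measure.ae_ae_of_ae_prod ((quasiMeasurePreserving_line v).ae h)

/-- Integration along lines: each line parallel to the unit vector `v` meets the slab
`0 ≤ ⟪v, r⟫ ≤ 1` in a segment of length one. -/
theorem lintegral_eq_lintegral_slab {F : Space → ℝ≥0∞} (hF : AEMeasurable F) {v : Space}
    (hv : ‖v‖ = 1) :
    ∫⁻ x, F x = ∫⁻ r in {r : Space | inner ℝ v r ∈ Set.Icc (0 : ℝ) 1}, ∫⁻ t : ℝ, F (r + t • v) := by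
  set S : Set Space := {r : Space | inner ℝ v r ∈ Set.Icc (0 : ℝ) 1} with hSdef
  have hS : MeasurableSet S := measurableSet_Icc.preimage (by fun_prop)
  set I : Space → ℝ≥0∞ := S.indicator 1
  have hI : Measurable I := measurable_one.indicator hS
  have hFl : AEMeasurable (fun p : Space × ℝ => F (p.1 + p.2 • v))
      ((volume : Measure Space).prod volume) :=
    hF.comp_quasiMeasurePreserving (quasiMeasurePreserving_line v)
  have hline : ∀ r, ∫⁻ t : ℝ, I (r - t • v) = 1 := by
    intro r
    have : (fun t : ℝ => I (r - t • v)) =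
        (Set.Icc (inner ℝ v r - 1) (inner ℝ v r)).indicator 1 := by
      ext t
      have hmem : r - t • v ∈ S ↔ t ∈ Set.Icc (inner ℝ v r - 1) (inner ℝ v r) := by
        simp only [hSdef, Set.mem_ofPred_eq, inner_sub_right, inner_smul_right,
          real_inner_self_eq_norm_sq, hv, Set.mem_Icc]
        constructor <;> rintro ⟨h1, h2⟩ <;> constructor <;> linarith
      by_cases h : r - t • v ∈ S
      · simp [I, h, hmem.1 h]
      · simp [I, h, mt hmem.2 h]
    rw [this, lintegral_indicator_one measurableSet_Icc]
    simp
  -- Insert `1 = ∫ I (x - t • v) dt`, swap, translate by `t • v`, and swap back. No change of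
  -- coordinates is needed.
  calc ∫⁻ x, F x = ∫⁻ x, ∫⁻ t : ℝ, I (x - t • v) * F x := by
        refine lintegral_congr fun x => ?_
        rw [lintegral_mul_const _ (f := fun t : ℝ => I (x - t • v)) (hI.comp (by fun_prop)), hline, one_mul]
    _ = ∫⁻ t : ℝ, ∫⁻ x, I (x - t • v) * F x := by
        refine lintegral_lintegral_swap ?_
        refine AEMeasurable.mul (hI.comp (by fun_prop)).aemeasurable ?_
        exact hF.comp_fst
    _ = ∫⁻ t : ℝ, ∫⁻ x, I x * F (x + t • v) := by
        refine lintegral_congr fun t => ?_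
        rw [← lintegral_add_right_eq_self _ (t • v)]
        simp
    _ = ∫⁻ x, ∫⁻ t : ℝ, I x * F (x + t • v) := by
        refine (lintegral_lintegral_swap ?_).symm
        exact (hI.comp measurable_fst).aemeasurable.mul hFl
    _ = _ := by
        rw [← lintegral_indicator hS]
        refine lintegral_congr fun x => ?_
        by_cases h : x ∈ S <;> simp [I, h]

theorem lintegral_le_of_ae_line {F G : Space → ℝ≥0∞} (hF : AEMeasurable F) (hG : AEMeasurable G)
    {v : Space} (hv : ‖v‖ = 1)
    (h : ∀ᵐ r : Space, ∫⁻ t : ℝ, F (r + t • v) ≤ ∫⁻ t : ℝ, G (r + t • v)) :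
    ∫⁻ x, F x ≤ ∫⁻ x, G x := by
  rw [lintegral_eq_lintegral_slab hF hv, lintegral_eq_lintegral_slab hG hv]
  exact lintegral_mono_ae (ae_restrict_of_ae h)

/-! ### Chords and the energy estimate on phase space -/

/-- A line through a point of a bounded open convex set meets it in a bounded open interval, whose
left end is at the exit distance. -/
theorem exists_chord_eq_Ioo {V : Set Space} (hVo : IsOpen V) (hVc : Convex ℝ V)
    (hVb : Bornology.IsBounded V) {r : Space} (hr : r ∈ V) (Ω : Direction) :
    ∃ A B : ℝ, A < 0 ∧ 0 < B ∧ {t : ℝ | r + t • (Ω : Space) ∈ V} = Set.Ioo A B ∧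
      exitDistance V r Ω = -A := by
  have hΩ : ‖(Ω : Space)‖ = 1 := by simp
  set J : Set ℝ := {t : ℝ | r + t • (Ω : Space) ∈ V} with hJ
  have hJo : IsOpen J := hVo.preimage (by fun_prop)
  have h0 : (0 : ℝ) ∈ J := by simp [hJ, hr]
  have hJc : Convex ℝ J := by
    intro x hx y hy a b ha hb hab
    have := hVc hx hy ha hb hab
    simp only [hJ, Set.mem_ofPred_eq]
    convert this using 1
    rw [smul_add, smul_add, add_add_add_comm, ← add_smul, hab, one_smul, add_smul, smul_smul,
      smul_smul, smul_eq_mul, smul_eq_mul]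
  obtain ⟨R, hR⟩ := hVb.exists_norm_le
  have hJR : ∀ t ∈ J, |t| ≤ R + ‖r‖ := by
    intro t ht
    have h1 : ‖t • (Ω : Space)‖ ≤ ‖r + t • (Ω : Space)‖ + ‖r‖ := by
      simpa using norm_sub_le (r + t • (Ω : Space)) r
    rw [norm_smul, hΩ, mul_one, Real.norm_eq_abs] at h1
    linarith [hR _ ht]
  have hbb : BddBelow J := ⟨-(R + ‖r‖), fun t ht => (abs_le.1 (hJR t ht)).1⟩
  have hba : BddAbove J := ⟨R + ‖r‖, fun t ht => (abs_le.1 (hJR t ht)).2⟩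
  have hconn : IsConnected J := ⟨⟨0, h0⟩, hJc.isPreconnected⟩
  have hmem : ∀ t ∈ J, ∃ ε > 0, t - ε ∈ J ∧ t + ε ∈ J := by
    intro t ht
    obtain ⟨ε, hε, hball⟩ := Metric.isOpen_iff.1 hJo t ht
    refine ⟨ε / 2, by positivity, hball ?_, hball ?_⟩ <;>
      simp [abs_of_pos hε, hε]
  have hIoo : J = Set.Ioo (sInf J) (sSup J) := by
    refine Set.Subset.antisymm (fun t ht => ?_) (hconn.Ioo_csInf_csSup_subset hbb hba)
    obtain ⟨ε, hε, h1, h2⟩ := hmem t ht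
    exact ⟨by linarith [csInf_le hbb h1], by linarith [le_csSup hba h2]⟩
  have h0' := h0
  rw [hIoo] at h0'
  refine ⟨sInf J, sSup J, h0'.1, h0'.2, hIoo, ?_⟩
  -- For `s > 0` the time `-s` is negative, so it can leave the chord only through the left end.
  have hset : {s : ℝ | 0 < s ∧ r - s • (Ω : Space) ∉ V} = Set.Ici (-sInf J) := by
    ext s
    have hs : r - s • (Ω : Space) ∈ V ↔ -s ∈ Set.Ioo (sInf J) (sSup J) := by
      rw [← hIoo, hJ, Set.mem_ofPred_eq, neg_smul, sub_eq_add_neg]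
    simp only [Set.mem_ofPred_eq, hs, Set.mem_Ioo, Set.mem_Ici, not_and, not_lt]
    constructor
    · rintro ⟨hs0, h⟩
      by_contra hlt
      linarith [h (by linarith), h0'.2]
    · intro h
      exact ⟨by linarith [h0'.1], fun h' => by linarith⟩
  rw [exitDistance, hset, csInf_Ici]

/-- Energy estimate for the transport equation in a fixed direction. -/
theorem lintegral_direction_energy_le {V : Set Space} (hVo : IsOpen V) (hVc : Convex ℝ V)
    (hVb : Bornology.IsBounded V) {σ g u : Space → ℝ} (hσ : IsCrossSection V σ)
    (hg : AEMeasurable g (volume.restrict V)) (hu : AEMeasurable u (volume.restrict V))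
    (Ω : Direction)
    (hac : ∀ᵐ r ∂(volume.restrict V), ∀ a b : ℝ,
      (∀ t ∈ Set.uIcc a b, r + t • (Ω : Space) ∈ V) →
        AbsolutelyContinuousOnInterval (fun t => u (r + t • (Ω : Space))) a b)
    (heq : ∀ᵐ r ∂(volume.restrict V), HasLineDerivAt ℝ u (g r - σ r * u r) r (Ω : Space))
    (hvac : ∀ᵐ r ∂(volume.restrict V),
      Tendsto (fun s => u (r - s • (Ω : Space))) (𝓝[<] (exitDistance V r Ω)) (𝓝 0)) :
    ∫⁻ r in V, ENNReal.ofReal (|u r| ^ 2 * σ r) ≤ ∫⁻ r in V, ENNReal.ofReal (g r ^ 2 / σ r) := by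
  obtain ⟨hσm, m, M, hm, hmM⟩ := hσ
  have hV : MeasurableSet V := hVo.measurableSet
  rw [← lintegral_indicator hV, ← lintegral_indicator hV]
  refine lintegral_le_of_ae_line (v := Ω)
    ((aemeasurable_indicator_iff hV).2 ((hu.abs.pow_const 2).mul hσm).ennreal_ofReal)
    ((aemeasurable_indicator_iff hV).2 ((hg.pow_const 2).div hσm).ennreal_ofReal) (by simp) ?_
  have hσi : AEMeasurable (V.indicator σ) := (aemeasurable_indicator_iff hV).2 hσm
  have hσl : ∀ᵐ r : Space, AEMeasurable (fun t : ℝ => V.indicator σ (r + t • (Ω : Space))) := by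
    have h := (hσi.comp_quasiMeasurePreserving
      (quasiMeasurePreserving_line (Ω : Space))).aestronglyMeasurable.prodMk_left
    exact h.mono fun r hr => hr.aemeasurable
  rw [ae_restrict_iff' hV] at hac heq hvac
  filter_upwards [hσl, ae_ae_line (hac.and hvac) (Ω : Space), ae_ae_line heq (Ω : Space)]
    with r hσr hgood hder
  by_cases hmeet : ∃ t : ℝ, r + t • (Ω : Space) ∈ V
  swap
  · push Not at hmeet
    simp [hmeet]
  have hopen : IsOpen {t : ℝ | r + t • (Ω : Space) ∈ V} := hVo.preimage (by fun_prop)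
  -- The chord is open and nonempty, hence of positive measure, so some point of it satisfies the
  -- a.e. hypotheses. Absolute continuity and inflow known from that one base point cover the whole
  -- chord.
  obtain ⟨t₀, ht₀, hgood₀⟩ : ∃ t₀ : ℝ, r + t₀ • (Ω : Space) ∈ V ∧
      ((r + t₀ • (Ω : Space) ∈ V → ∀ a b : ℝ,
        (∀ t ∈ Set.uIcc a b, r + t₀ • (Ω : Space) + t • (Ω : Space) ∈ V) →
        AbsolutelyContinuousOnInterval
          (fun t => u (r + t₀ • (Ω : Space) + t • (Ω : Space))) a b) ∧
      (r + t₀ • (Ω : Space) ∈ V →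
        Tendsto (fun s => u (r + t₀ • (Ω : Space) - s • (Ω : Space)))
          (𝓝[<] (exitDistance V (r + t₀ • (Ω : Space)) Ω)) (𝓝 0))) := by
    have hpos : volume {t : ℝ | r + t • (Ω : Space) ∈ V} ≠ 0 := (hopen.measure_pos _ hmeet).ne'
    obtain ⟨t, ht, htV⟩ :=
      (hgood.and_frequently (frequently_ae_iff.2 hpos)).exists
    exact ⟨t, htV, ht⟩
  set r₀ := r + t₀ • (Ω : Space) with hr₀
  have hshift : ∀ t : ℝ, r₀ + t • (Ω : Space) = r + (t + t₀) • (Ω : Space) := fun t => by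
    rw [hr₀, add_smul]; abel
  obtain ⟨A, B, hA, hB, hAB, hd⟩ := exists_chord_eq_Ioo hVo hVc hVb ht₀ Ω
  have hmemV : ∀ t : ℝ, r₀ + t • (Ω : Space) ∈ V ↔ t ∈ Set.Ioo A B := fun t => by
    rw [← hAB]; rfl
  have hreduce : ∀ f : Space → ℝ, ∫⁻ t : ℝ, V.indicator (fun x => ENNReal.ofReal (f x))
      (r + t • (Ω : Space)) =
      ∫⁻ t in Set.Ioo A B, ENNReal.ofReal (f (r₀ + t • (Ω : Space))) := by
    intro f
    rw [← lintegral_add_right_eq_self _ t₀, ← lintegral_indicator measurableSet_Ioo]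
    refine lintegral_congr fun t => ?_
    rw [← hshift]
    by_cases h : t ∈ Set.Ioo A B
    · rw [Set.indicator_of_mem h, Set.indicator_of_mem ((hmemV t).2 h)]
    · rw [Set.indicator_of_notMem h, Set.indicator_of_notMem (mt (hmemV t).1 h)]
  rw [hreduce, hreduce]
  have hqmp : Measure.QuasiMeasurePreserving (fun t : ℝ => t + t₀) volume volume :=
    (measurePreserving_add_right volume t₀).quasiMeasurePreserving
  refine lintegral_Ioo_energy_le (u := fun t => u (r₀ + t • (Ω : Space)))
    (s := fun t => σ (r₀ + t • (Ω : Space))) (g := fun t => g (r₀ + t • (Ω : Space)))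
    (M := M) (hA.trans hB) ?_ ?_ ?_ ?_ ?_ ?_
  · exact fun a b hab => hgood₀.1 ht₀ a b fun t ht => (hmemV t).2 (hab ht)
  · have h1 := (hσr.comp_quasiMeasurePreserving hqmp).restrict (s := Set.Ioo A B)
    refine h1.congr ?_
    filter_upwards [ae_restrict_mem measurableSet_Ioo] with t ht
    simp only [Function.comp_apply]
    rw [← hshift, Set.indicator_of_mem ((hmemV t).2 ht)]
  · exact fun t ht => hm.trans_le (hmM _ ((hmemV t).2 ht)).1
  · exact fun t ht => (hmM _ ((hmemV t).2 ht)).2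
  · filter_upwards [hqmp.ae hder] with t ht htm
    rw [← hshift] at ht
    have h1 := ht ((hmemV t).2 htm)
    have h2 : HasDerivAt (fun s : ℝ => u (r₀ + t • (Ω : Space) + s • (Ω : Space)))
      (g (r₀ + t • (Ω : Space)) - σ (r₀ + t • (Ω : Space)) * u (r₀ + t • (Ω : Space))) (t - t) := by
      rw [sub_self]; exact h1
    have h3 := h2.comp_sub_const t t
    refine h3.congr_of_eventuallyEq (Eventually.of_forall fun s => ?_)
    simp only
    rw [add_assoc r₀, ← add_smul, add_sub_cancel]
  · have h1 := hgood₀.2 ht₀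
    rw [hd] at h1
    have h2 : Tendsto (fun t : ℝ => -t) (𝓝[>] A) (𝓝[<] (-A)) := tendsto_neg_nhdsGT
    refine (h1.comp h2).congr fun t => ?_
    simp

/-- Energy estimate for the transport equation on phase space. -/
theorem IsTransportSolution.lintegral_energy_le {V : Set Space} (hVo : IsOpen V)
    (hVc : Convex ℝ V) (hVb : Bornology.IsBounded V) {σ g : Space → ℝ}
    {ψ : Space → Direction → ℝ} (hσ : IsCrossSection V σ)
    (hg : AEMeasurable g (volume.restrict V)) (h : IsTransportSolution V σ g ψ) :
    ∫⁻ r in V, ∫⁻ Ω, ENNReal.ofReal (|ψ r Ω| ^ 2 * σ r) ∂surfaceMeasure ≤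
      surfaceMeasure Set.univ * ∫⁻ r in V, ENNReal.ofReal (g r ^ 2 / σ r) := by
  have hswap : ∀ {P : Space × Direction → Prop}, (∀ᵐ p ∂phaseMeasure V, P p) →
      ∀ᵐ Ω ∂surfaceMeasure, ∀ᵐ r ∂volume.restrict V, P (r, Ω) := fun {P} hP =>
    Measure.ae_ae_of_ae_prod (p := fun q : Direction × Space => P q.swap)
      (Measure.measurePreserving_swap.quasiMeasurePreserving.ae hP)
  have hmeas : AEMeasurable (fun p : Space × Direction =>
      ENNReal.ofReal (|ψ p.1 p.2| ^ 2 * σ p.1)) (phaseMeasure V) :=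
    ((h.measurable.aemeasurable.abs.pow_const 2).mul hσ.1.comp_fst).ennreal_ofReal
  -- The right side does not depend on `Ω`: the total mass of the sphere is the integral of a
  -- constant over directions.
  rw [lintegral_lintegral_swap hmeas, mul_comm, ← lintegral_const]
  refine lintegral_mono_ae ?_
  filter_upwards [hswap h.absolutelyContinuous, hswap h.equation, hswap h.vacuum,
    h.measurable.prod_swap.prodMk_left] with Ω hac heq hvac hm
  refine lintegral_direction_energy_le hVo hVc hVb hσ hg hm.aemeasurable Ω hac ?_ hvac
  filter_upwards [heq] with r hr
  have := hr.1.hasLineDerivAt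
  rwa [show lineDeriv ℝ (fun x => ψ x Ω) r (Ω : Space) = g r - σ r * ψ r Ω by
    rw [← hr.2, transportOp]; ring] at this

/-! ### The angular average -/

theorem surfaceMeasure_univ : surfaceMeasure Set.univ = ENNReal.ofReal (4 * Real.pi) := by
  rw [Measure.toSphere_apply_univ, EuclideanSpace.volume_ball_fin_three]
  simp only [finrank_euclideanSpace, Fintype.card_fin, ENNReal.ofReal_one, one_pow, one_mul]
  rw [show ((3 : ℕ) : ℝ≥0∞) = ENNReal.ofReal 3 by simp, ← ENNReal.ofReal_mul (by norm_num)]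
  congr 1
  ring

/-- Cauchy–Schwarz against the constant 1. -/
theorem lintegral_enorm_sq_le {α : Type*} [MeasurableSpace α] {μ : Measure α} {f : α → ℝ}
    (hf : AEStronglyMeasurable f μ) :
    (∫⁻ x, ‖f x‖ₑ ∂μ) ^ 2 ≤ μ Set.univ * ∫⁻ x, ‖f x‖ₑ ^ 2 ∂μ := by
  have h := eLpNorm_le_eLpNorm_mul_rpow_measure_univ (p := 1) (q := 2) (by norm_num) hf
  rw [eLpNorm_one_eq_lintegral_enorm,
    eLpNorm_eq_lintegral_rpow_enorm_toReal (by simp) (by simp)] at h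
  refine (pow_le_pow_left' h 2).trans (le_of_eq ?_)
  rw [mul_pow, ← ENNReal.rpow_natCast, ← ENNReal.rpow_mul, ← ENNReal.rpow_natCast,
    ← ENNReal.rpow_mul, mul_comm]
  norm_num

theorem ofReal_average_sq_le (ψ : Space → Direction → ℝ) (r : Space) (w : ℝ) :
    ENNReal.ofReal (|average ψ r| ^ 2 * w) ≤ (surfaceMeasure Set.univ)⁻¹ *
      ∫⁻ Ω, ENNReal.ofReal (|ψ r Ω| ^ 2 * w) ∂surfaceMeasure := by
  have hsq : ∀ x : ℝ, ENNReal.ofReal (|x| ^ 2 * w) = ‖x‖ₑ ^ 2 * ENNReal.ofReal w := fun x => by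
    rw [ENNReal.ofReal_mul (by positivity), ENNReal.ofReal_pow (abs_nonneg x),
      Real.enorm_eq_ofReal_abs]
  by_cases hm : AEStronglyMeasurable (ψ r) surfaceMeasure
  swap
  -- Here the Bochner integral takes its default value 0.
  · simp [average, integral_non_aestronglyMeasurable hm]
  simp only [hsq]
  rw [lintegral_mul_const' _ _ ENNReal.ofReal_ne_top, ← mul_assoc]
  gcongr
  have hπ : (0 : ℝ) < 4 * Real.pi := by positivity
  have hc : ‖(1 / (4 * Real.pi) : ℝ)‖ₑ = (surfaceMeasure Set.univ)⁻¹ := by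
    rw [surfaceMeasure_univ, Real.enorm_of_nonneg (by positivity), one_div,
      ENNReal.ofReal_inv_of_pos hπ]
  have h0 : surfaceMeasure Set.univ ≠ 0 := by
    rw [surfaceMeasure_univ]
    simpa using Real.pi_pos
  have htop : surfaceMeasure Set.univ ≠ ∞ := measure_ne_top _ _
  calc ‖average ψ r‖ₑ ^ 2
      = (surfaceMeasure Set.univ)⁻¹ ^ 2 * ‖∫ Ω, ψ r Ω ∂surfaceMeasure‖ₑ ^ 2 := by
        rw [average, enorm_mul, hc, mul_pow]
    _ ≤ (surfaceMeasure Set.univ)⁻¹ ^ 2 *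
        (surfaceMeasure Set.univ * ∫⁻ Ω, ‖ψ r Ω‖ₑ ^ 2 ∂surfaceMeasure) := by
        gcongr
        exact (pow_le_pow_left' (enorm_integral_le_lintegral_enorm _) 2).trans
          (lintegral_enorm_sq_le hm)
    _ = _ := by
        rw [sq, mul_assoc, ← mul_assoc _ (surfaceMeasure Set.univ), ENNReal.inv_mul_cancel h0 htop,
          one_mul]

theorem lintegral_average_sq_le (V : Set Space) (ψ : Space → Direction → ℝ) (w : Space → ℝ) :
    ∫⁻ r in V, ENNReal.ofReal (|average ψ r| ^ 2 * w r) ≤ (surfaceMeasure Set.univ)⁻¹ *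
      ∫⁻ r in V, ∫⁻ Ω, ENNReal.ofReal (|ψ r Ω| ^ 2 * w r) ∂surfaceMeasure := by
  rw [← lintegral_const_mul' _ _ (by simp [Real.pi_pos])]
  exact lintegral_mono fun r => ofReal_average_sq_le ψ r (w r)

/-! ### Square integrability and linearity -/

theorem memLp_two_of_weighted {α : Type*} [MeasurableSpace α] {μ : Measure α} {f w : α → ℝ}
    {m : ℝ} (hm : 0 < m) (hw : ∀ᵐ x ∂μ, m ≤ w x) (hf : AEStronglyMeasurable f μ)
    (h : ∫⁻ x, ENNReal.ofReal (|f x| ^ 2 * w x) ∂μ ≠ ∞) : MemLp f 2 μ := by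
  rw [memLp_two_iff_integrable_sq hf]
  refine ⟨hf.pow 2, ?_⟩
  rw [hasFiniteIntegral_iff_ofReal (Eventually.of_forall fun x => sq_nonneg _)]
  have hle : ENNReal.ofReal m * ∫⁻ x, ENNReal.ofReal (f x ^ 2) ∂μ ≤
      ∫⁻ x, ENNReal.ofReal (|f x| ^ 2 * w x) ∂μ := by
    rw [← lintegral_const_mul' _ _ ENNReal.ofReal_ne_top]
    refine lintegral_mono_ae (hw.mono fun x hx => ?_)
    rw [← ENNReal.ofReal_mul hm.le, sq_abs, mul_comm]
    exact ENNReal.ofReal_le_ofReal (mul_le_mul_of_nonneg_left hx (sq_nonneg _))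
  refine lt_top_iff_ne_top.2 fun htop => h ?_
  rw [htop, ENNReal.mul_top (by simpa using hm)] at hle
  exact top_le_iff.1 hle

theorem lintegral_weighted_ne_top {α : Type*} [MeasurableSpace α] {μ : Measure α} {f w : α → ℝ}
    {M : ℝ} (hw : ∀ᵐ x ∂μ, w x ≤ M) (hf : MemLp f 2 μ) :
    ∫⁻ x, ENNReal.ofReal (|f x| ^ 2 * w x) ∂μ ≠ ∞ := by
  refine ne_top_of_le_ne_top (hf.integrable_sq.const_mul M).lintegral_lt_top.ne
    (lintegral_mono_ae (hw.mono fun x hx => ENNReal.ofReal_le_ofReal ?_))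
  rw [sq_abs, mul_comm]
  exact mul_le_mul_of_nonneg_right hx (sq_nonneg _)

theorem IsTransportSolution.sub {V : Set Space} {σ g₁ g₂ : Space → ℝ}
    {ψ₁ ψ₂ : Space → Direction → ℝ} (h₁ : IsTransportSolution V σ g₁ ψ₁)
    (h₂ : IsTransportSolution V σ g₂ ψ₂) :
    IsTransportSolution V σ (fun r => g₁ r - g₂ r) (fun r Ω => ψ₁ r Ω - ψ₂ r Ω) where
  measurable := h₁.measurable.sub h₂.measurable
  absolutelyContinuous := by
    filter_upwards [h₁.absolutelyContinuous, h₂.absolutelyContinuous] with p hp₁ hp₂ a b hab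
    exact (hp₁ a b hab).fun_sub (hp₂ a b hab)
  equation := by
    filter_upwards [h₁.equation, h₂.equation] with p hp₁ hp₂
    have hd : HasLineDerivAt ℝ (fun x => ψ₁ x p.2 - ψ₂ x p.2) _ p.1 (p.2 : Space) :=
      HasDerivAt.fun_sub hp₁.1.hasLineDerivAt hp₂.1.hasLineDerivAt
    refine ⟨hd.lineDifferentiableAt, ?_⟩
    rw [transportOp, hd.lineDeriv, ← hp₁.2, ← hp₂.2, transportOp, transportOp]
    ring
  vacuum := by
    filter_upwards [h₁.vacuum, h₂.vacuum] with p hp₁ hp₂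
    simpa using hp₁.sub hp₂

/-- The factor `4π` from the isotropic source cancels the `1/(4π)` from Cauchy–Schwarz, leaving
constant 1. -/
theorem IsTransportSolution.lintegral_average_le {V : Set Space} (hVo : IsOpen V)
    (hVc : Convex ℝ V) (hVb : Bornology.IsBounded V) {σ g : Space → ℝ}
    {ψ : Space → Direction → ℝ} (hσ : IsCrossSection V σ)
    (hg : AEMeasurable g (volume.restrict V)) (h : IsTransportSolution V σ g ψ) :
    ∫⁻ r in V, ENNReal.ofReal (|average ψ r| ^ 2 * σ r) ≤
      ∫⁻ r in V, ENNReal.ofReal (g r ^ 2 / σ r) := by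
  refine (lintegral_average_sq_le V ψ σ).trans ?_
  refine (mul_le_mul_right (h.lintegral_energy_le hVo hVc hVb hσ hg) _).trans (le_of_eq ?_)
  rw [← mul_assoc, ENNReal.inv_mul_cancel, one_mul]
  · rw [surfaceMeasure_univ]
    simpa using Real.pi_pos
  · exact measure_ne_top _ _

/-- The iterates `ψⁱ⁺¹` are not assumed square integrable; the energy estimate provides it, as `σ`
and `1/σ` are bounded. -/
theorem IsTransportSolution.memLp {V : Set Space} (hVo : IsOpen V)
    (hVc : Convex ℝ V) (hVb : Bornology.IsBounded V) {σ g : Space → ℝ}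
    {ψ : Space → Direction → ℝ} (hσ : IsCrossSection V σ)
    (hg : MemLp g 2 (volume.restrict V)) (h : IsTransportSolution V σ g ψ) :
    MemLp (fun p : Space × Direction => ψ p.1 p.2) 2 (phaseMeasure V) := by
  have hV := hVo.measurableSet
  have hE := h.lintegral_energy_le hVo hVc hVb hσ hg.1.aemeasurable
  obtain ⟨hσm, m, M, hm, hmM⟩ := hσ
  have hmem : ∀ᵐ r ∂volume.restrict V, r ∈ V := ae_restrict_mem hV
  refine memLp_two_of_weighted (w := fun p => σ p.1) hm ?_ h.measurable ?_
  · exact Measure.quasiMeasurePreserving_fst.ae (hmem.mono fun r hr => (hmM r hr).1)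
  · have hmeas : AEMeasurable (fun p : Space × Direction =>
        ENNReal.ofReal (|ψ p.1 p.2| ^ 2 * σ p.1)) (phaseMeasure V) :=
      ((h.measurable.aemeasurable.abs.pow_const 2).mul hσm.comp_fst).ennreal_ofReal
    rw [lintegral_prod _ hmeas]
    refine ne_top_of_le_ne_top (ENNReal.mul_ne_top (measure_ne_top _ _) ?_) hE
    have := lintegral_weighted_ne_top (w := fun r => (σ r)⁻¹) (M := m⁻¹)
      (hmem.mono fun r hr => inv_anti₀ hm (hmM r hr).1) hg
    simpa only [sq_abs, div_eq_mul_inv] using this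

theorem memLp_average {V : Set Space} {ψ : Space → Direction → ℝ}
    (h : MemLp (fun p : Space × Direction => ψ p.1 p.2) 2 (phaseMeasure V)) :
    MemLp (average ψ) 2 (volume.restrict V) := by
  have hm : AEStronglyMeasurable (average ψ) (volume.restrict V) :=
    h.1.integral_prod_right'.const_mul _
  refine memLp_two_of_weighted (w := fun _ => 1) one_pos (by simp) hm ?_
  refine ne_top_of_le_ne_top ?_
    (lintegral_average_sq_le V ψ fun _ => 1)
  refine ENNReal.mul_ne_top (by simp [Real.pi_pos]) ?_
  have := lintegral_weighted_ne_top (w := fun _ => 1) (M := 1) (by simp) h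
  have hmeas : AEMeasurable (fun p : Space × Direction =>
      ENNReal.ofReal (|ψ p.1 p.2| ^ 2 * 1)) (phaseMeasure V) :=
    ((h.1.aemeasurable.abs.pow_const 2).mul_const 1).ennreal_ofReal
  rwa [lintegral_prod _ hmeas] at this

/-- Bochner integrals subtract only for integrable slices. Over a bounded `V`, `L²` functions on
phase space are integrable, so almost every slice is. -/
theorem average_sub_ae {V : Set Space} (hVb : Bornology.IsBounded V)
    {ψ₁ ψ₂ : Space → Direction → ℝ}
    (h₁ : MemLp (fun p : Space × Direction => ψ₁ p.1 p.2) 2 (phaseMeasure V))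
    (h₂ : MemLp (fun p : Space × Direction => ψ₂ p.1 p.2) 2 (phaseMeasure V)) :
    ∀ᵐ r ∂volume.restrict V,
      average (fun r Ω => ψ₁ r Ω - ψ₂ r Ω) r = average ψ₁ r - average ψ₂ r := by
  have : IsFiniteMeasure (volume.restrict V) := ⟨by simpa using hVb.measure_lt_top⟩
  filter_upwards [(h₁.integrable (by norm_num)).prod_right_ae,
    (h₂.integrable (by norm_num)).prod_right_ae] with r hr₁ hr₂
  simp only [average]
  rw [integral_sub hr₁ hr₂, mul_sub]

/-! ### Cross-sections and the contraction factor -/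

theorem IsCrossSection.add {V : Set Space} {s₁ s₂ : Space → ℝ} (h₁ : IsCrossSection V s₁)
    (h₂ : IsCrossSection V s₂) : IsCrossSection V (fun r => s₁ r + s₂ r) := by
  obtain ⟨hm₁, m₁, M₁, h0₁, hb₁⟩ := h₁
  obtain ⟨hm₂, m₂, M₂, h0₂, hb₂⟩ := h₂
  exact ⟨hm₁.add hm₂, m₁ + m₂, M₁ + M₂, by positivity, fun r hr =>
    ⟨add_le_add (hb₁ r hr).1 (hb₂ r hr).1, add_le_add (hb₁ r hr).2 (hb₂ r hr).2⟩⟩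

theorem IsCrossSection.congr {V : Set Space} (hV : MeasurableSet V) {s₁ s₂ : Space → ℝ}
    (h : IsCrossSection V s₁) (heq : ∀ r ∈ V, s₂ r = s₁ r) : IsCrossSection V s₂ := by
  obtain ⟨hm, m, M, h0, hb⟩ := h
  refine ⟨hm.congr ?_, m, M, h0, fun r hr => by rw [heq r hr]; exact hb r hr⟩
  filter_upwards [ae_restrict_mem hV] with r hr using (heq r hr).symm

theorem IsCrossSection.memLp_mul {V : Set Space} (hV : MeasurableSet V) {s f : Space → ℝ}
    (h : IsCrossSection V s) (hf : MemLp f 2 (volume.restrict V)) :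
    MemLp (fun r => s r * f r) 2 (volume.restrict V) := by
  obtain ⟨hm, m, M, h0, hb⟩ := h
  refine hf.of_le_mul (c := M) (hm.aestronglyMeasurable.mul hf.1) ?_
  filter_upwards [ae_restrict_mem hV] with r hr
  rw [norm_mul, Real.norm_of_nonneg (h0.le.trans (hb r hr).1)]
  exact mul_le_mul_of_nonneg_right (hb r hr).2 (norm_nonneg _)

theorem supNorm_div_lt_one {V : Set Space} (hV : MeasurableSet V) {σ σS σA : Space → ℝ}
    (hσS : IsCrossSection V σS) (hσA : IsCrossSection V σA)
    (hσ : ∀ r ∈ V, σ r = σS r + σA r) : supNorm V (fun r => σS r / σ r) < 1 := by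
  obtain ⟨-, m₁, M, h0₁, hb₁⟩ := hσS
  obtain ⟨-, m, M₂, h0, hb⟩ := hσA
  -- `x/(x+y)` increases in `x` and decreases in `y`, whence the bound `|M|/(|M|+m)`. The absolute
  -- value covers empty `V`, where `M` may be negative.
  have hpos : 0 < |M| + m := by positivity
  rw [supNorm, eLpNorm_exponent_top]
  refine (eLpNormEssSup_le_of_ae_bound (C := |M| / (|M| + m)) ?_).trans_lt ?_
  · filter_upwards [ae_restrict_mem hV] with r hr
    have hS := h0₁.trans_le (hb₁ r hr).1
    have hA := h0.trans_le (hb r hr).1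
    have hSM := (hb₁ r hr).2.trans (le_abs_self M)
    rw [hσ r hr, Real.norm_of_nonneg (by positivity), div_le_div_iff₀ (by positivity) hpos]
    nlinarith [mul_le_mul hSM (hb r hr).1 h0.le (abs_nonneg M)]
  · rw [← ENNReal.ofReal_one, ENNReal.ofReal_lt_ofReal_iff one_pos, div_lt_one hpos]
    linarith

theorem lintegral_source_le {V : Set Space} (hV : MeasurableSet V) {σ σS : Space → ℝ}
    (hσ : ∀ r ∈ V, 0 < σ r) (hc : supNorm V (fun r => σS r / σ r) ≠ ∞) (v : Space → ℝ) :
    ∫⁻ r in V, ENNReal.ofReal ((σS r * v r) ^ 2 / σ r) ≤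
      supNorm V (fun r => σS r / σ r) ^ 2 * ∫⁻ r in V, ENNReal.ofReal (|v r| ^ 2 * σ r) := by
  have hbound := enorm_ae_le_eLpNormEssSup (fun r => σS r / σ r) (volume.restrict V)
  rw [← eLpNorm_exponent_top] at hbound
  rw [← lintegral_const_mul' _ _ (ENNReal.pow_ne_top hc)]
  refine lintegral_mono_ae ?_
  filter_upwards [hbound, ae_restrict_mem hV] with r hr hrV
  have hpos := hσ r hrV
  rw [show (σS r * v r) ^ 2 / σ r = |σS r / σ r| ^ 2 * (|v r| ^ 2 * σ r) by
    rw [sq_abs, sq_abs]; field_simp, ENNReal.ofReal_mul (by positivity),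
    ENNReal.ofReal_pow (abs_nonneg _), ← Real.enorm_eq_ofReal_abs]
  gcongr
  exact hr

end RadiativeTransport

/-! ### Convergence of source iteration -/

theorem mainTheorem2
    (V : Set RadiativeTransport.Space) (hVopen : IsOpen V) (hVconvex : Convex ℝ V)
    (hVbounded : Bornology.IsBounded V)
    (σ σS σA Q : RadiativeTransport.Space → ℝ)
    (hσS : RadiativeTransport.IsCrossSection V σS)
    (hσA : RadiativeTransport.IsCrossSection V σA)
    (hσ : ∀ r ∈ V, σ r = σS r + σA r)
    (hQ : MemLp Q 2 (volume.restrict V))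
    (ψ : RadiativeTransport.Space → RadiativeTransport.Direction → ℝ)
    (hψ : RadiativeTransport.IsRTESolution V σ σS Q ψ)
    (φ : RadiativeTransport.Space → ℝ)
    (hφ : ∀ r ∈ V, φ r = RadiativeTransport.average ψ r)
    (φit : ℕ → RadiativeTransport.Space → ℝ)
    (hφit : RadiativeTransport.IsSourceIteration V σ σS Q φit)
    (e : ℕ → RadiativeTransport.Space → ℝ)
    (he : ∀ i r, e i r = φ r - φit i r) :
    (∀ i, MemLp (e i) 2 (volume.restrict V)) ∧
    (∀ i, RadiativeTransport.weightedNorm V σ (e (i + 1)) ≤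
      RadiativeTransport.supNorm V (fun r => σS r / σ r) *
        RadiativeTransport.weightedNorm V σ (e i)) ∧
    RadiativeTransport.supNorm V (fun r => σS r / σ r) < 1 ∧
    Tendsto (fun i => RadiativeTransport.weightedNorm V σ (e i)) atTop (𝓝 0) := by

  have hV := hVopen.measurableSet
  have hσc : RadiativeTransport.IsCrossSection V σ := (hσS.add hσA).congr hV hσ
  have hσpos : ∀ r ∈ V, 0 < σ r := by
    obtain ⟨-, m, M, hm, hmM⟩ := hσc
    exact fun r hr => hm.trans_le (hmM r hr).1
  have hlt := RadiativeTransport.supNorm_div_lt_one hV hσS hσA hσ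
  obtain ⟨hφ0, hit⟩ := hφit
  choose χ hχ hχφ using hit
  have hmemV : ∀ᵐ r ∂volume.restrict V, r ∈ V := ae_restrict_mem hV
  have hφψ : φ =ᵐ[volume.restrict V] RadiativeTransport.average ψ := hmemV.mono hφ
  have hφL : MemLp φ 2 (volume.restrict V) :=
    (memLp_congr_ae hφψ).2 (RadiativeTransport.memLp_average hψ.1)
  have hχL : ∀ i, MemLp (φit i) 2 (volume.restrict V) →
      MemLp (fun p : RadiativeTransport.Space × RadiativeTransport.Direction => χ i p.1 p.2) 2
        (RadiativeTransport.phaseMeasure V) := fun i hi =>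
    (hχ i).memLp hVopen hVconvex hVbounded hσc ((hσS.memLp_mul hV hi).add hQ)
  have hitL : ∀ i, MemLp (φit i) 2 (volume.restrict V) := by
    intro i
    induction i with
    | zero => exact hφ0
    | succ i ih =>
      exact (memLp_congr_ae (hmemV.mono (hχφ i))).2
        (RadiativeTransport.memLp_average (hχL i ih))
  have heL : ∀ i, MemLp (e i) 2 (volume.restrict V) := fun i => by
    rw [show e i = fun r => φ r - φit i r from funext (he i)]
    exact hφL.sub (hitL i)
  have hstep : ∀ i, RadiativeTransport.weightedNorm V σ (e (i + 1)) ≤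
      RadiativeTransport.supNorm V (fun r => σS r / σ r) *
        RadiativeTransport.weightedNorm V σ (e i) := by
    intro i
    -- The source of the difference is `σ_S eⁱ`, since `Q` cancels.
    have hsub := hψ.2.sub (hχ i)
    have hg : (fun r => σS r * RadiativeTransport.average ψ r + Q r - (σS r * φit i r + Q r))
        =ᵐ[volume.restrict V] fun r => σS r * e i r := by
      filter_upwards [hφψ] with r hr
      rw [he, hr]
      ring
    have hbound := hsub.lintegral_average_le hVopen hVconvex hVbounded hσc
      ((hσS.memLp_mul hV (heL i)).1.aemeasurable.congr hg.symm)
    have hleft : ∫⁻ r in V, ENNReal.ofReal (|e (i + 1) r| ^ 2 * σ r) =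
        ∫⁻ r in V, ENNReal.ofReal
          (|RadiativeTransport.average (fun r Ω => ψ r Ω - χ i r Ω) r| ^ 2 * σ r) := by
      refine lintegral_congr_ae ?_
      filter_upwards [RadiativeTransport.average_sub_ae hVbounded hψ.1 (hχL i (hitL i)), hφψ, hmemV]
        with r hr hr' hrV
      rw [hr, he, hr', hχφ i r hrV]
    have hright : ∫⁻ r in V, ENNReal.ofReal
        ((σS r * RadiativeTransport.average ψ r + Q r - (σS r * φit i r + Q r)) ^ 2 / σ r) =
        ∫⁻ r in V, ENNReal.ofReal ((σS r * e i r) ^ 2 / σ r) :=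
      lintegral_congr_ae (hg.mono fun r hr => by simp only [hr])
    rw [← hleft, hright] at hbound
    have htotal := hbound.trans
      (RadiativeTransport.lintegral_source_le hV hσpos hlt.ne_top (e i))
    have hroot := ENNReal.rpow_le_rpow htotal (z := 1 / 2) (by norm_num)
    rw [ENNReal.mul_rpow_of_nonneg _ _ (by norm_num), ← ENNReal.rpow_natCast,
      ← ENNReal.rpow_mul] at hroot
    norm_num at hroot
    simpa [RadiativeTransport.weightedNorm] using hroot
  refine ⟨heL, hstep, hlt, ?_⟩
  -- Finiteness excludes the form `0 · ∞` in the limit of `cⁱ ‖e⁰‖`.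
  have hfin : RadiativeTransport.weightedNorm V σ (e 0) ≠ ∞ := by
    obtain ⟨-, m, M, hm, hmM⟩ := hσc
    exact ENNReal.rpow_ne_top_of_nonneg (by norm_num)
      (RadiativeTransport.lintegral_weighted_ne_top (hmemV.mono fun r hr => (hmM r hr).2) (heL 0))
  have hpow : ∀ i, RadiativeTransport.weightedNorm V σ (e i) ≤
      RadiativeTransport.supNorm V (fun r => σS r / σ r) ^ i *
        RadiativeTransport.weightedNorm V σ (e 0) := by
    intro i
    induction i with
    | zero => simp
    | succ i ih =>
      refine (hstep i).trans ((mul_le_mul_right ih _).trans (le_of_eq ?_))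
      rw [pow_succ', mul_assoc]
  have hlim := ENNReal.Tendsto.mul_const (b := RadiativeTransport.weightedNorm V σ (e 0))
    (ENNReal.tendsto_pow_atTop_nhds_zero_of_lt_one hlt) (Or.inr hfin)
  rw [zero_mul] at hlim
  exact tendsto_of_tendsto_of_tendsto_of_le_of_le tendsto_const_nhds hlim (fun _ => zero_le) hpow
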